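/- Let $E$ be an order continuous (real) Banach lattice, that is, every downward directed subset of $E$ with infimum $0$, viewed as a decreasing net, converges to $0$ in norm; let $Y$ be a (real) Banach space, and let $L(E,Y)$ be the space of bounded linear operators from $E$ to $Y$ with the operator norm. Let $\mathrm{ds}(E)$ be the set of all sequences $(x_n)_{n\in\mathbb N}$ of non-zero, pairwise disjoint vectors of $E$ (that is, $|x_m|\wedge|x_n|=0$ for $m\neq n$), let $[x_n]$ be the closed linear span of $(x_n)$, and let $T_M$ be the restriction of $T$ to a subspace $M$. A bounded operator is called strictly singular if its restriction to any closed infinite-dimensional subspace of its domain is not an isomorphism onto its range. Put $$\mathrm{DSS}(E,Y)=\{T\in L(E,Y): \text{there is no }(x_n)\in \mathrm{ds}(E)\text{ such that }T_{[x_n]}\text{ is an isomorphism onto its range}\},$$ $$\mathrm{DNS}(E,Y)=\{T\in L(E,Y): \text{there is no }(x_n)\in \mathrm{ds}(E)\text{ such that }T_{[x_n]}\text{ is strictly singular}\},$$ and $\Gamma_d(T)=\inf_{(x_n)\in \mathrm{ds}(E)}\|T_{[x_n]}\|$ for $T\in L(E,Y)$ (with $\inf\emptyset=\infty$). Then: 1.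 $\mathrm{DSS}(E,Y)$ is a closed linear subspace of $L(E,Y)$; 2. $\mathrm{DNS}(E,Y)$ is an open subset of $L(E,Y)$; 3. if $S\in\mathrm{DSS}(E,Y)$, then $\Gamma_d(T+S)=\Gamma_d(T)$ for all $T\in L(E,Y)$; and if in addition $T\in\mathrm{DNS}(E,Y)$, then $T+S\in\mathrm{DNS}(E,Y)$. -/

import Mathlib

open scoped ENNReal

noncomputable section

/-- The norm of the Banach lattice `E` is order continuous: every nonempty downward directed set
with infimum `0`, regarded as a decreasing net, converges to `0` in norm. -/
def IsOrderContinuousNorm (E : Type*) [NormedAddCommGroup E] [Lattice E] : Prop :=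
  ∀ A : Set E, A.Nonempty → DirectedOn (fun a b => b ≤ a) A → IsGLB A 0 →
    ∀ ε : ℝ, 0 < ε → ∃ a ∈ A, ∀ b ∈ A, b ≤ a → ‖b‖ < ε

/-- `ds(E)`: the sequences of pairwise disjoint non-zero vectors of `E`. -/
def disjointSeqs (E : Type*) [NormedAddCommGroup E] [Lattice E] : Set (ℕ → E) :=
  {x | (∀ n, x n ≠ 0) ∧ ∀ m n, m ≠ n → |x m| ⊓ |x n| = 0}

/-- `[x_n]`: the closed linear span of the sequence `x`. -/
def closedSpan {E : Type*} [NormedAddCommGroup E] [NormedSpace ℝ E] (x : ℕ → E) :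
    Submodule ℝ E :=
  (Submodule.span ℝ (Set.range x)).topologicalClosure

/-- `T` is an isomorphism (a linear homeomorphism) onto its range. -/
def IsIsoOntoRange {X Y : Type*} [NormedAddCommGroup X] [NormedSpace ℝ X]
    [NormedAddCommGroup Y] [NormedSpace ℝ Y] (T : X →L[ℝ] Y) : Prop :=
  Topology.IsEmbedding (fun x => T x)

/-- `T` is strictly singular: there is no closed infinite dimensional subspace of its domain on
which `T` is an isomorphism. -/
def IsStrictlySingular {X Y : Type*} [NormedAddCommGroup X] [NormedSpace ℝ X]
    [NormedAddCommGroup Y] [NormedSpace ℝ Y] (T : X →L[ℝ] Y) : Prop :=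
  ¬ ∃ M : Submodule ℝ X, IsClosed (M : Set X) ∧ ¬ FiniteDimensional ℝ M ∧
    IsIsoOntoRange (T.domRestrict M)

/-- `DSS(E, Y)`: the disjointly strictly singular operators. -/
def DSS (E Y : Type*) [NormedAddCommGroup E] [NormedSpace ℝ E] [Lattice E]
    [NormedAddCommGroup Y] [NormedSpace ℝ Y] : Set (E →L[ℝ] Y) :=
  {T | ¬ ∃ x ∈ disjointSeqs E, IsIsoOntoRange (T.domRestrict (closedSpan x))}

/-- `DNS(E, Y)`: the disjointly non-singular operators. -/
def DNS (E Y : Type*) [NormedAddCommGroup E] [NormedSpace ℝ E] [Lattice E]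
    [NormedAddCommGroup Y] [NormedSpace ℝ Y] : Set (E →L[ℝ] Y) :=
  {T | ¬ ∃ x ∈ disjointSeqs E, IsStrictlySingular (T.domRestrict (closedSpan x))}

/-- `Γ_d(T)`: the infimum of the operator norms of the restrictions of `T` to the subspaces
`[x_n]`, for `(x_n)` in `ds(E)`.  It is finite as soon as `ds(E)` is nonempty; the infimum of the
empty set is `∞`. -/
def gammaD {E Y : Type*} [NormedAddCommGroup E] [NormedSpace ℝ E] [Lattice E]
    [NormedAddCommGroup Y] [NormedSpace ℝ Y] (T : E →L[ℝ] Y) : ℝ≥0∞ :=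
  ⨅ x ∈ disjointSeqs E, ENNReal.ofReal ‖T.domRestrict (closedSpan x)‖

end

/-! ### Disjointness in vector lattices -/

section Disjointness

variable {E : Type*} [NormedAddCommGroup E] [Lattice E] [IsOrderedAddMonoid E]

/-! Everything rests on disjoint sequences with `‖R (x k)‖ ≤ K * (1 / 2) ^ k * ‖x k‖`. Disjointness
bounds each term of a finite combination by the norm of the whole (`norm_coeff_smul_le`), so `R` has
norm at most `2 * K` on `[x]` and arbitrarily small norm on its tails. Tails have finite
codimension, so `R` is strictly singular on `[x]`. Conversely, an operator that is an isomorphism on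
no tail of `[x]` is summably small on a block sequence of `x` (`exists_block_seq`). Passing to such
blocks for `S` in `DSS` gives the sum and perturbation statements.

Openness of `DNS` is the only place for order continuity. A limit `T` of operators outside `DNS` is
within `δ` of zero on some normalized disjoint sequence, but that sequence depends on `δ`. One
vector is picked from each; since `|u| ⊓ c • |x n|` tends to `0` in norm, the picks can be made
almost disjoint. Soft thresholding makes them exactly disjoint at a summable cost, and `T` is
summably small on the result. -/

theorem inf_add_le_of_nonneg {a b c : E} (ha : 0 ≤ a) (hb : 0 ≤ b) (hc : 0 ≤ c) :
    a ⊓ (b + c) ≤ a ⊓ b + a ⊓ c := by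
  rw [add_inf, inf_add, inf_add]
  refine le_inf (le_inf ?_ ?_) (le_inf ?_ ?_)
  · exact inf_le_left.trans (le_add_of_nonneg_left ha)
  · exact inf_le_left.trans (le_add_of_nonneg_left hb)
  · exact inf_le_left.trans (le_add_of_nonneg_right hc)
  · exact inf_le_right

theorem abs_inf_abs_add_eq_zero {u v w : E} (hv : |u| ⊓ |v| = 0) (hw : |u| ⊓ |w| = 0) :
    |u| ⊓ |v + w| = 0 := by
  refine le_antisymm ?_ (le_inf (abs_nonneg _) (abs_nonneg _))
  calc |u| ⊓ |v + w| ≤ |u| ⊓ (|v| + |w|) := inf_le_inf_left _ (abs_add_le _ _)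
    _ ≤ |u| ⊓ |v| + |u| ⊓ |w| :=
      inf_add_le_of_nonneg (abs_nonneg _) (abs_nonneg _) (abs_nonneg _)
    _ = 0 := by rw [hv, hw, add_zero]

theorem inf_nsmul_eq_zero {a b : E} (ha : 0 ≤ a) (hb : 0 ≤ b) (h : a ⊓ b = 0) (n : ℕ) :
    a ⊓ n • b = 0 := by
  induction n with
  | zero => simpa using ha
  | succ n ih =>
    rw [succ_nsmul]
    refine le_antisymm ?_ (le_inf ha (add_nonneg (nsmul_nonneg hb n) hb))
    simpa [ih, h] using inf_add_le_of_nonneg ha (nsmul_nonneg hb n) hb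

variable [NormedSpace ℝ E] [IsOrderedModule ℝ E]

theorem inf_smul_eq_zero {a b : E} (ha : 0 ≤ a) (hb : 0 ≤ b) (h : a ⊓ b = 0) {c : ℝ}
    (hc : 0 ≤ c) : a ⊓ c • b = 0 := by
  obtain ⟨n, hn⟩ := exists_nat_ge c
  refine le_antisymm ?_ (le_inf ha (smul_nonneg hc hb))
  rw [← inf_nsmul_eq_zero ha hb h n, ← Nat.cast_smul_eq_nsmul ℝ]
  exact inf_le_inf_left _ (smul_le_smul_of_nonneg_right hn hb)

omit [IsOrderedAddMonoid E] in
theorem abs_smul_le (c : ℝ) (u : E) : |c • u| ≤ |c| • |u| := by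
  have key : ∀ (d : ℝ) (w : E), d • w ≤ |d| • |w| := by
    intro d w
    rcases le_total 0 d with h | h
    · rw [abs_of_nonneg h]
      exact smul_le_smul_of_nonneg_left (le_abs_self w) h
    · rw [abs_of_nonpos h, ← neg_smul_neg]
      exact smul_le_smul_of_nonneg_left (neg_le_abs w) (neg_nonneg.2 h)
  refine abs_le'.2 ⟨key c u, ?_⟩
  simpa using key c (-u)

theorem abs_inf_abs_smul_eq_zero {u v : E} (h : |u| ⊓ |v| = 0) (c : ℝ) : |u| ⊓ |c • v| = 0 := by
  refine le_antisymm ?_ (le_inf (abs_nonneg _) (abs_nonneg _))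
  rw [← inf_smul_eq_zero (abs_nonneg u) (abs_nonneg v) h (abs_nonneg c)]
  exact inf_le_inf_left _ (abs_smul_le _ _)

/-- The vectors disjoint from `u`. -/
def disjointComplement (u : E) : Submodule ℝ E where
  carrier := {v | |u| ⊓ |v| = 0}
  zero_mem' := by simp
  add_mem' := abs_inf_abs_add_eq_zero
  smul_mem' c _ h := abs_inf_abs_smul_eq_zero h c

theorem mem_disjointComplement {u v : E} : v ∈ disjointComplement u ↔ |u| ⊓ |v| = 0 := Iff.rfl

theorem mem_disjointComplement_comm {u v : E} :
    v ∈ disjointComplement u ↔ u ∈ disjointComplement v := by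
  rw [mem_disjointComplement, mem_disjointComplement, inf_comm]

omit [NormedSpace ℝ E] [IsOrderedModule ℝ E] in
theorem abs_le_abs_add_of_disjoint {u v : E} (h : |u| ⊓ |v| = 0) : |u| ≤ |u + v| := by
  have h1 : |u| ≤ |u + v| + |v| := by simpa using abs_add_le (u + v) (-v)
  calc |u| = |u| ⊓ (|u + v| + |v|) := (inf_eq_left.2 h1).symm
    _ ≤ |u| ⊓ |u + v| + |u| ⊓ |v| :=
      inf_add_le_of_nonneg (abs_nonneg _) (abs_nonneg _) (abs_nonneg _)
    _ ≤ |u + v| := by rw [h, add_zero]; exact inf_le_right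

omit [IsOrderedAddMonoid E] [NormedSpace ℝ E] [IsOrderedModule ℝ E] in
theorem disjointSeqs_comp {x : ℕ → E} (hx : x ∈ disjointSeqs E) {f : ℕ → ℕ}
    (hf : Function.Injective f) : x ∘ f ∈ disjointSeqs E :=
  ⟨fun _ => hx.1 _, fun _ _ hmn => hx.2 _ _ (hf.ne hmn)⟩

omit [IsOrderedAddMonoid E] [NormedSpace ℝ E] [IsOrderedModule ℝ E] in
theorem disjointSeqs_tail {x : ℕ → E} (hx : x ∈ disjointSeqs E) (N : ℕ) :
    (fun k => x (N + k)) ∈ disjointSeqs E :=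
  disjointSeqs_comp hx (add_right_injective N)

theorem exists_disjoint_tail {x : ℕ → E} (hx : x ∈ disjointSeqs E) {u : E}
    (hu : u ∈ Submodule.span ℝ (Set.range x)) :
    ∃ N, ∀ i, N ≤ i → x i ∈ disjointComplement u := by
  simp_rw [mem_disjointComplement_comm (u := u)]
  induction hu using Submodule.span_induction with
  | mem u hu =>
    obtain ⟨k, rfl⟩ := hu
    exact ⟨k + 1, fun i hi => hx.2 i k (by omega)⟩
  | zero => exact ⟨0, fun i _ => zero_mem _⟩
  | add u v _ _ hu hv =>
    obtain ⟨N, hN⟩ := hu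
    obtain ⟨K, hK⟩ := hv
    exact ⟨max N K, fun i hi => add_mem (hN i (le_of_max_le_left hi)) (hK i (le_of_max_le_right hi))⟩
  | smul c u _ hu =>
    obtain ⟨N, hN⟩ := hu
    exact ⟨N, fun i hi => Submodule.smul_mem _ c (hN i hi)⟩

end Disjointness

/-! ### Closed spans and their finite-codimensional tails -/

section ClosedSpan

variable {E : Type*} [NormedAddCommGroup E] [NormedSpace ℝ E]

theorem mem_closedSpan (x : ℕ → E) (n : ℕ) : x n ∈ closedSpan x :=
  Submodule.le_topologicalClosure _ (Submodule.subset_span ⟨n, rfl⟩)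

theorem isClosed_closedSpan (x : ℕ → E) : IsClosed (closedSpan x : Set E) :=
  Submodule.isClosed_topologicalClosure _

theorem span_le_closedSpan (x : ℕ → E) : Submodule.span ℝ (Set.range x) ≤ closedSpan x :=
  Submodule.le_topologicalClosure _

theorem closedSpan_le {x : ℕ → E} {M : Submodule ℝ E} (hM : IsClosed (M : Set E))
    (h : ∀ n, x n ∈ M) : closedSpan x ≤ M :=
  Submodule.topologicalClosure_minimal _ (Submodule.span_le.2 (by rintro _ ⟨n, rfl⟩; exact h n)) hM

theorem closedSpan_tail_le (x : ℕ → E) (N : ℕ) : closedSpan (fun k => x (N + k)) ≤ closedSpan x :=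
  closedSpan_le (isClosed_closedSpan x) fun _ => mem_closedSpan x _

theorem closedSpan_le_of_mem_span {x y : ℕ → E} (h : ∀ n, y n ∈ Submodule.span ℝ (Set.range x)) :
    closedSpan y ≤ closedSpan x :=
  closedSpan_le (isClosed_closedSpan x) fun n => span_le_closedSpan x (h n)

theorem closedSpan_le_sup_tail (x : ℕ → E) (N : ℕ) :
    closedSpan x ≤
      closedSpan (fun k => x (N + k)) ⊔ Submodule.span ℝ (x '' (Finset.range N : Set ℕ)) := by
  have hfin : FiniteDimensional ℝ (Submodule.span ℝ (x '' (Finset.range N : Set ℕ))) :=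
    FiniteDimensional.span_of_finite ℝ ((Finset.finite_toSet _).image _)
  refine closedSpan_le (Submodule.isClosed_sup_finiteDimensional _ _ (isClosed_closedSpan _))
    fun n => ?_
  rcases lt_or_ge n N with h | h
  · exact Submodule.mem_sup_right (Submodule.subset_span ⟨n, by simpa using h, rfl⟩)
  · obtain ⟨k, rfl⟩ := Nat.exists_eq_add_of_le h
    exact Submodule.mem_sup_left (mem_closedSpan (fun k => x (N + k)) k)

/-- The image of `M` in the quotient by `K` lies in the image of `F`, and the kernel of `M → E ⧸ K`
is `M ⊓ K`. -/
theorem not_finiteDimensional_inf_of_le_sup {M K F : Submodule ℝ E} [FiniteDimensional ℝ F]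
    (hM : ¬ FiniteDimensional ℝ M) (h : M ≤ K ⊔ F) :
    ¬ FiniteDimensional ℝ (M ⊓ K : Submodule ℝ E) := by
  intro hfin
  refine hM ?_
  have hmap : M.map K.mkQ ≤ F.map K.mkQ := by
    refine (Submodule.map_mono h).trans ?_
    rw [Submodule.map_sup, Submodule.mkQ_map_self, bot_sup_eq]
  have h1 : FiniteDimensional ℝ (M.map K.mkQ) := Submodule.finiteDimensional_of_le hmap
  rw [← Submodule.fg_iff_finiteDimensional] at hfin h1 ⊢
  exact Submodule.fg_of_fg_map_of_fg_inf_ker K.mkQ h1 (by rwa [Submodule.ker_mkQ])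

end ClosedSpan

/-! ### Isomorphisms and strict singularity as norm estimates -/

section Isomorphisms

variable {E Y : Type*} [NormedAddCommGroup E] [NormedSpace ℝ E] [NormedAddCommGroup Y]
  [NormedSpace ℝ Y]

theorem isIsoOntoRange_iff {X : Type*} [NormedAddCommGroup X] [NormedSpace ℝ X] (T : X →L[ℝ] Y) :
    IsIsoOntoRange T ↔ ∃ c : ℝ, 0 < c ∧ ∀ v, c * ‖v‖ ≤ ‖T v‖ := by
  constructor
  · intro h
    obtain ⟨K, hK⟩ := T.antilipschitz_of_isEmbedding h
    -- The antilipschitz constant `K` may be `0`, hence the `+ 1`.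
    refine ⟨((K : ℝ) + 1)⁻¹, by positivity, fun v => ?_⟩
    have h1 := hK.le_mul_dist v 0
    rw [map_zero, dist_zero_right, dist_zero_right] at h1
    rw [inv_mul_le_iff₀ (by positivity)]
    nlinarith [norm_nonneg (T v)]
  · rintro ⟨c, hc, h⟩
    have : AntilipschitzWith (Real.toNNReal c⁻¹) T := T.antilipschitz_of_bound fun v => by
      rw [Real.coe_toNNReal _ (inv_nonneg.2 hc.le), le_inv_mul_iff₀ hc]
      exact h v
    exact this.isEmbedding T.continuous

theorem isIsoOntoRange_domRestrict_iff (T : E →L[ℝ] Y) (M : Submodule ℝ E) :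
    IsIsoOntoRange (T.domRestrict M) ↔ ∃ c : ℝ, 0 < c ∧ ∀ v ∈ M, c * ‖v‖ ≤ ‖T v‖ := by
  rw [isIsoOntoRange_iff]
  simp [Subtype.forall]

theorem not_isIsoOntoRange_domRestrict_iff (T : E →L[ℝ] Y) (M : Submodule ℝ E) :
    ¬ IsIsoOntoRange (T.domRestrict M) ↔ ∀ c : ℝ, 0 < c → ∃ v ∈ M, ‖T v‖ < c * ‖v‖ := by
  rw [isIsoOntoRange_domRestrict_iff]
  push Not
  rfl

theorem isStrictlySingular_domRestrict_iff (T : E →L[ℝ] Y) {L : Submodule ℝ E}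
    (hL : IsClosed (L : Set E)) :
    IsStrictlySingular (T.domRestrict L) ↔
      ∀ M : Submodule ℝ E, M ≤ L → IsClosed (M : Set E) → ¬ FiniteDimensional ℝ M →
        ∀ c : ℝ, 0 < c → ∃ v ∈ M, ‖T v‖ < c * ‖v‖ := by
  unfold IsStrictlySingular
  push Not
  constructor
  · intro h M hML hM hfin
    have h1 := h (M.comap L.subtype) (hM.preimage continuous_subtype_val)
      (fun hf => hfin (LinearEquiv.finiteDimensional (Submodule.comapSubtypeEquivOfLe hML)))
    rw [not_isIsoOntoRange_domRestrict_iff] at h1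
    intro c hc
    obtain ⟨v, hv, hlt⟩ := h1 c hc
    exact ⟨v, hv, hlt⟩
  · intro h M hM hfin
    rw [not_isIsoOntoRange_domRestrict_iff]
    intro c hc
    obtain ⟨_, ⟨v, hv, rfl⟩, hlt⟩ := h (M.map L.subtype) (Submodule.map_subtype_le L M)
      (hL.isClosedEmbedding_subtypeVal.isClosedMap _ hM)
      (fun hf => hfin (LinearEquiv.finiteDimensional
        (Submodule.equivMapOfInjective L.subtype L.injective_subtype M).symm)) c hc
    exact ⟨v, hv, hlt⟩

end Isomorphisms

/-! ### Summably small operators and block sequences -/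

section Blocks

variable {E Y : Type*} [NormedAddCommGroup E] [Lattice E] [IsOrderedAddMonoid E]
  [NormedSpace ℝ E] [IsOrderedModule ℝ E] [HasSolidNorm E]
  [NormedAddCommGroup Y] [NormedSpace ℝ Y]

theorem norm_coeff_smul_le {x : ℕ → E} (hx : x ∈ disjointSeqs E) (a : ℕ → ℝ) {s : Finset ℕ}
    {k : ℕ} (hk : k ∈ s) : |a k| * ‖x k‖ ≤ ‖∑ i ∈ s, a i • x i‖ := by
  have hd : ∑ i ∈ s.erase k, a i • x i ∈ disjointComplement (a k • x k) := by
    refine Submodule.sum_mem _ fun i hi => Submodule.smul_mem _ _ ?_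
    rw [mem_disjointComplement_comm]
    exact Submodule.smul_mem _ _ (hx.2 i k (Finset.ne_of_mem_erase hi))
  rw [← Finset.add_sum_erase s _ hk]
  calc |a k| * ‖x k‖ = ‖a k • x k‖ := by rw [norm_smul, Real.norm_eq_abs]
    _ ≤ _ := norm_le_norm_of_abs_le_abs (abs_le_abs_add_of_disjoint hd)

theorem norm_le_on_closedSpan {x : ℕ → E} (hx : x ∈ disjointSeqs E) (R : E →L[ℝ] Y) {K : ℝ}
    (hK : 0 ≤ K) (hR : ∀ k, ‖R (x k)‖ ≤ K * (1 / 2) ^ k * ‖x k‖) {v : E}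
    (hv : v ∈ closedSpan x) : ‖R v‖ ≤ 2 * K * ‖v‖ := by
  have hclosed : IsClosed {v : E | ‖R v‖ ≤ 2 * K * ‖v‖} :=
    isClosed_le (by fun_prop) (by fun_prop)
  refine closure_minimal (s := (Submodule.span ℝ (Set.range x) : Set E)) ?_ hclosed hv
  intro v hv
  obtain ⟨a, rfl⟩ := (Finsupp.mem_span_range_iff_exists_finsupp).1 hv
  simp only [Finsupp.sum, Set.mem_ofPred_eq, map_sum, map_smul]
  set V := ‖∑ i ∈ a.support, a i • x i‖ with hV
  calc ‖∑ i ∈ a.support, a i • R (x i)‖ ≤ ∑ i ∈ a.support, ‖a i • R (x i)‖ := norm_sum_le _ _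
    _ ≤ ∑ i ∈ a.support, (1 / 2 : ℝ) ^ i * (K * V) := by
      refine Finset.sum_le_sum fun i hi => ?_
      rw [norm_smul, Real.norm_eq_abs]
      calc |a i| * ‖R (x i)‖ ≤ |a i| * (K * (1 / 2) ^ i * ‖x i‖) := by gcongr; exact hR i
        _ = (1 / 2) ^ i * (K * (|a i| * ‖x i‖)) := by ring
        _ ≤ _ := by gcongr; exact norm_coeff_smul_le hx a hi
    _ = (∑ i ∈ a.support, (1 / 2 : ℝ) ^ i) * (K * V) := by rw [Finset.sum_mul]
    _ ≤ 2 * (K * V) := by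
      gcongr
      exact (summable_geometric_two.sum_le_tsum _ fun i _ => by positivity).trans_eq
        tsum_geometric_two
    _ = 2 * K * V := by ring

theorem norm_le_on_closedSpan_tail {x : ℕ → E} (hx : x ∈ disjointSeqs E) (R : E →L[ℝ] Y) {K : ℝ}
    (hK : 0 ≤ K) (hR : ∀ k, ‖R (x k)‖ ≤ K * (1 / 2) ^ k * ‖x k‖) {c : ℝ} (hc : 0 < c) :
    ∃ N, ∀ v ∈ closedSpan fun k => x (N + k), ‖R v‖ ≤ c * ‖v‖ := by
  -- The tail from `N` satisfies the hypothesis with `K * (1 / 2) ^ N` in place of `K`.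
  obtain ⟨N, hN⟩ := exists_pow_lt_of_lt_one (show 0 < c / (2 * K + 1) by positivity)
    (show (1 / 2 : ℝ) < 1 by norm_num)
  refine ⟨N, fun v hv => ?_⟩
  have h1 := norm_le_on_closedSpan (disjointSeqs_tail hx N) R (K := K * (1 / 2) ^ N)
    (by positivity) (fun k => by simpa only [pow_add, mul_assoc] using hR (N + k)) hv
  refine h1.trans (mul_le_mul_of_nonneg_right ?_ (norm_nonneg v))
  rw [lt_div_iff₀ (by positivity)] at hN
  nlinarith [pow_pos (show (0 : ℝ) < 1 / 2 by norm_num) N]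

theorem exists_small_subspace {x : ℕ → E} (hx : x ∈ disjointSeqs E) (R : E →L[ℝ] Y) {K : ℝ}
    (hK : 0 ≤ K) (hR : ∀ k, ‖R (x k)‖ ≤ K * (1 / 2) ^ k * ‖x k‖) {c : ℝ} (hc : 0 < c)
    {M : Submodule ℝ E} (hM : M ≤ closedSpan x) (hMc : IsClosed (M : Set E))
    (hMf : ¬ FiniteDimensional ℝ M) :
    ∃ M' ≤ M, IsClosed (M' : Set E) ∧ ¬ FiniteDimensional ℝ M' ∧ ∀ v ∈ M', ‖R v‖ ≤ c * ‖v‖ := by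
  obtain ⟨N, hN⟩ := norm_le_on_closedSpan_tail hx R hK hR hc
  have hfin : FiniteDimensional ℝ (Submodule.span ℝ (x '' (Finset.range N : Set ℕ))) :=
    FiniteDimensional.span_of_finite ℝ ((Finset.finite_toSet _).image _)
  exact ⟨M ⊓ closedSpan fun k => x (N + k), inf_le_left, hMc.inter (isClosed_closedSpan _),
    not_finiteDimensional_inf_of_le_sup hMf (hM.trans (closedSpan_le_sup_tail x N)),
    fun v hv => hN v hv.2⟩

theorem isStrictlySingular_of_summable {x : ℕ → E} (hx : x ∈ disjointSeqs E) (R : E →L[ℝ] Y)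
    {K : ℝ} (hK : 0 ≤ K) (hR : ∀ k, ‖R (x k)‖ ≤ K * (1 / 2) ^ k * ‖x k‖) :
    IsStrictlySingular (R.domRestrict (closedSpan x)) := by
  rw [isStrictlySingular_domRestrict_iff R (isClosed_closedSpan x)]
  intro M hM hMc hMf c hc
  obtain ⟨M', hM', -, hf, hsmall⟩ := exists_small_subspace hx R hK hR (half_pos hc) hM hMc hMf
  have hne : M' ≠ ⊥ := by
    rintro rfl
    exact hf inferInstance
  obtain ⟨v, hv, hv0⟩ := Submodule.exists_mem_ne_zero_of_ne_bot hne
  exact ⟨v, hM' hv, (hsmall v hv).trans_lt (by nlinarith [norm_pos_iff.2 hv0])⟩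

theorem linearIndependent_of_mem_disjointSeqs {x : ℕ → E} (hx : x ∈ disjointSeqs E) :
    LinearIndependent ℝ x := by
  rw [linearIndependent_iff']
  intro s a ha k hk
  have h := norm_coeff_smul_le hx a hk
  rw [ha, norm_zero] at h
  have hpos : 0 < ‖x k‖ := norm_pos_iff.2 (hx.1 k)
  by_contra hne
  exact absurd h (not_le.2 (mul_pos (abs_pos.2 hne) hpos))

theorem not_finiteDimensional_closedSpan {x : ℕ → E} (hx : x ∈ disjointSeqs E) :
    ¬ FiniteDimensional ℝ (closedSpan x) := by
  intro hfin
  have hli : LinearIndependent ℝ fun n => (⟨x n, mem_closedSpan x n⟩ : closedSpan x) :=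
    LinearIndependent.of_comp (closedSpan x).subtype (linearIndependent_of_mem_disjointSeqs hx)
  exact not_finite_iff_infinite.2 (inferInstanceAs (Infinite ℕ)) hli.finite

omit [Lattice E] [IsOrderedAddMonoid E] [IsOrderedModule ℝ E] [HasSolidNorm E] in
-- The strict inequality is an open condition and the span is dense. Blocks are wanted in the span
-- itself, where each is disjoint from a whole tail of `x`.
theorem exists_mem_span_norm_lt (R : E →L[ℝ] Y) {x : ℕ → E} {c : ℝ}
    (h : ∃ v ∈ closedSpan x, ‖R v‖ < c * ‖v‖) :
    ∃ v ∈ Submodule.span ℝ (Set.range x), ‖R v‖ < c * ‖v‖ := by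
  obtain ⟨v, hv, hlt⟩ := h
  have hopen : IsOpen {v : E | ‖R v‖ < c * ‖v‖} := isOpen_lt (by fun_prop) (by fun_prop)
  obtain ⟨w, hw, hws⟩ := mem_closure_iff.1 (show v ∈ closure _ from hv) _ hopen hlt
  exact ⟨w, hws, hw⟩

omit [HasSolidNorm E] in
/-- If `R` is not an isomorphism on any tail of `[x]`, it is summably small on a block sequence. -/
theorem exists_block_seq {x : ℕ → E} (hx : x ∈ disjointSeqs E) (R : E →L[ℝ] Y)
    (hR : ∀ N, ¬ IsIsoOntoRange (R.domRestrict (closedSpan fun k => x (N + k)))) {ε : ℝ}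
    (hε : 0 < ε) :
    ∃ y ∈ disjointSeqs E, (∀ k, y k ∈ Submodule.span ℝ (Set.range x)) ∧
      ∀ k, ‖R (y k)‖ ≤ ε * (1 / 2) ^ k * ‖y k‖ := by
  -- The recursion sees only the finite set of earlier choices, so each vector carries its precision
  -- exponent; strict increase makes the `n`-th exponent at least `n`.
  have key := exists_seq_of_forall_finset_exists
    (fun p : ℕ × E => p.2 ≠ 0 ∧ p.2 ∈ Submodule.span ℝ (Set.range x) ∧
      ‖R p.2‖ ≤ ε * (1 / 2) ^ p.1 * ‖p.2‖)
    (fun p q => p.1 < q.1 ∧ q.2 ∈ disjointComplement p.2) ?_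
  · obtain ⟨f, hP, hr⟩ := key
    have hmono : StrictMono fun n => (f n).1 := fun m n hmn => (hr m n hmn).1
    refine ⟨fun n => (f n).2, ⟨fun n => (hP n).1, fun m n hmn => ?_⟩, fun n => (hP n).2.1,
      fun n => (hP n).2.2.trans ?_⟩
    · rcases hmn.lt_or_gt with h | h
      · exact (hr m n h).2
      · exact mem_disjointComplement_comm.1 (hr n m h).2
    · have : (1 / 2 : ℝ) ^ (f n).1 ≤ (1 / 2) ^ n :=
        pow_le_pow_of_le_one (by norm_num) (by norm_num) (hmono.le_apply)
      gcongr
  · intro s hs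
    have hN : ∀ p ∈ s, ∃ N, ∀ i, N ≤ i → x i ∈ disjointComplement p.2 :=
      fun p hp => exists_disjoint_tail hx (hs p hp).2.1
    choose! N hN using hN
    set n := s.sup N
    set k := s.sup Prod.fst + 1
    obtain ⟨v, hv, hlt⟩ := exists_mem_span_norm_lt R
      ((not_isIsoOntoRange_domRestrict_iff R _).1 (hR n) (ε * (1 / 2) ^ k) (by positivity))
    refine ⟨(k, v), ⟨?_, ?_, hlt.le⟩, fun p hp => ⟨Nat.lt_succ_of_le (Finset.le_sup hp), ?_⟩⟩
    · rintro rfl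
      simp at hlt
    · refine Submodule.span_mono ?_ hv
      rintro _ ⟨i, rfl⟩
      exact ⟨_, rfl⟩
    · refine Submodule.span_le.2 ?_ hv
      rintro _ ⟨i, rfl⟩
      exact hN p hp _ ((Finset.le_sup hp).trans (Nat.le_add_right _ _))

omit [HasSolidNorm E] in
theorem exists_block_seq_of_mem_DSS {S : E →L[ℝ] Y} (hS : S ∈ DSS E Y) {x : ℕ → E}
    (hx : x ∈ disjointSeqs E) {ε : ℝ} (hε : 0 < ε) :
    ∃ y ∈ disjointSeqs E, (∀ k, y k ∈ Submodule.span ℝ (Set.range x)) ∧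
      ∀ k, ‖S (y k)‖ ≤ ε * (1 / 2) ^ k * ‖y k‖ :=
  exists_block_seq hx S (fun N h => hS ⟨_, disjointSeqs_tail hx N, h⟩) hε

theorem exists_block_seq_of_isStrictlySingular {R : E →L[ℝ] Y} {x : ℕ → E}
    (hx : x ∈ disjointSeqs E) (hR : IsStrictlySingular (R.domRestrict (closedSpan x))) {ε : ℝ}
    (hε : 0 < ε) :
    ∃ y ∈ disjointSeqs E, (∀ k, y k ∈ Submodule.span ℝ (Set.range x)) ∧
      ∀ k, ‖R (y k)‖ ≤ ε * (1 / 2) ^ k * ‖y k‖ := by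
  refine exists_block_seq hx R (fun N => ?_) hε
  rw [not_isIsoOntoRange_domRestrict_iff]
  exact (isStrictlySingular_domRestrict_iff R (isClosed_closedSpan x)).1 hR _
    (closedSpan_tail_le x N) (isClosed_closedSpan _)
    (not_finiteDimensional_closedSpan (disjointSeqs_tail hx N))

theorem exists_closedSpan_le_norm_le {S : E →L[ℝ] Y} (hS : S ∈ DSS E Y) {x : ℕ → E}
    (hx : x ∈ disjointSeqs E) {ε : ℝ} (hε : 0 < ε) :
    ∃ y ∈ disjointSeqs E, closedSpan y ≤ closedSpan x ∧ ∀ v ∈ closedSpan y, ‖S v‖ ≤ ε * ‖v‖ := by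
  obtain ⟨y, hy, hyx, hSy⟩ := exists_block_seq_of_mem_DSS hS hx (half_pos hε)
  refine ⟨y, hy, closedSpan_le_of_mem_span hyx, fun v hv => ?_⟩
  have := norm_le_on_closedSpan hy S (half_pos hε).le hSy hv
  rwa [mul_div_cancel₀ _ (two_ne_zero' ℝ)] at this

end Blocks

/-! ### The subspace `DSS` and perturbation by its elements -/

section DSS

variable {E Y : Type*} [NormedAddCommGroup E] [Lattice E] [IsOrderedAddMonoid E]
  [NormedSpace ℝ E] [IsOrderedModule ℝ E] [HasSolidNorm E]
  [NormedAddCommGroup Y] [NormedSpace ℝ Y]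

omit [IsOrderedAddMonoid E] [IsOrderedModule ℝ E] [HasSolidNorm E] in
theorem mem_DSS_iff {T : E →L[ℝ] Y} :
    T ∈ DSS E Y ↔ ∀ x ∈ disjointSeqs E, ∀ c : ℝ, 0 < c → ∃ v ∈ closedSpan x, ‖T v‖ < c * ‖v‖ := by
  simp only [DSS, Set.mem_ofPred_eq, not_exists, not_and, not_isIsoOntoRange_domRestrict_iff]

omit [IsOrderedAddMonoid E] [IsOrderedModule ℝ E] [HasSolidNorm E] in
theorem zero_mem_DSS : (0 : E →L[ℝ] Y) ∈ DSS E Y := by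
  rw [mem_DSS_iff]
  intro x hx c hc
  have := norm_pos_iff.2 (hx.1 0)
  exact ⟨x 0, mem_closedSpan x 0, by simpa using mul_pos hc this⟩

theorem add_mem_DSS {S T : E →L[ℝ] Y} (hS : S ∈ DSS E Y) (hT : T ∈ DSS E Y) :
    S + T ∈ DSS E Y := by
  rw [mem_DSS_iff]
  intro x hx c hc
  obtain ⟨y, hy, hyx, hSy⟩ := exists_closedSpan_le_norm_le hS hx (half_pos hc)
  obtain ⟨v, hv, hlt⟩ := mem_DSS_iff.1 hT y hy (c / 2) (half_pos hc)
  refine ⟨v, hyx hv, ?_⟩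
  calc ‖(S + T) v‖ ≤ ‖S v‖ + ‖T v‖ := norm_add_le _ _
    _ < c / 2 * ‖v‖ + c / 2 * ‖v‖ := add_lt_add_of_le_of_lt (hSy v hv) hlt
    _ = c * ‖v‖ := by ring

omit [IsOrderedAddMonoid E] [IsOrderedModule ℝ E] [HasSolidNorm E] in
theorem smul_mem_DSS (a : ℝ) {T : E →L[ℝ] Y} (hT : T ∈ DSS E Y) : a • T ∈ DSS E Y := by
  rw [mem_DSS_iff]
  intro x hx c hc
  obtain ⟨v, hv, hlt⟩ := mem_DSS_iff.1 hT x hx (c / (|a| + 1)) (by positivity)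
  refine ⟨v, hv, ?_⟩
  rw [div_mul_eq_mul_div, lt_div_iff₀ (by positivity)] at hlt
  rw [smul_apply, norm_smul, Real.norm_eq_abs]
  nlinarith [norm_nonneg (T v)]

variable (E Y) in
/-- The disjointly strictly singular operators as a subspace of the bounded operators. -/
def DSSSubmodule : Submodule ℝ (E →L[ℝ] Y) where
  carrier := DSS E Y
  zero_mem' := zero_mem_DSS
  add_mem' := add_mem_DSS
  smul_mem' a _ := smul_mem_DSS a

omit [IsOrderedAddMonoid E] [IsOrderedModule ℝ E] [HasSolidNorm E] in
theorem isClosed_DSS : IsClosed (DSS E Y) := by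
  refine isClosed_of_closure_subset fun T hT => ?_
  rw [mem_DSS_iff]
  intro x hx c hc
  obtain ⟨S, hS, hST⟩ := Metric.mem_closure_iff.1 hT (c / 2) (half_pos hc)
  obtain ⟨v, hv, hlt⟩ := mem_DSS_iff.1 hS x hx (c / 2) (half_pos hc)
  refine ⟨v, hv, ?_⟩
  rw [dist_eq_norm] at hST
  calc ‖T v‖ = ‖(T - S) v + S v‖ := by simp
    _ ≤ ‖(T - S) v‖ + ‖S v‖ := norm_add_le _ _
    _ < c / 2 * ‖v‖ + c / 2 * ‖v‖ :=
      add_lt_add_of_le_of_lt ((T - S).le_of_opNorm_le hST.le v) hlt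
    _ = c * ‖v‖ := by ring

theorem gammaD_add_le {S : E →L[ℝ] Y} (hS : S ∈ DSS E Y) (T : E →L[ℝ] Y) :
    gammaD (T + S) ≤ gammaD T := by
  unfold gammaD
  refine le_iInf₂ fun x hx => ENNReal.le_of_forall_pos_le_add fun ε hε _ => ?_
  obtain ⟨y, hy, hyx, hSy⟩ := exists_closedSpan_le_norm_le hS hx (NNReal.coe_pos.2 hε)
  refine (iInf₂_le y hy).trans ?_
  rw [← ENNReal.ofReal_coe_nnreal, ← ENNReal.ofReal_add (norm_nonneg (T.domRestrict (closedSpan x))) ε.coe_nonneg]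
  refine ENNReal.ofReal_le_ofReal (ContinuousLinearMap.opNorm_le_bound _ (by positivity) ?_)
  rintro ⟨v, hv⟩
  calc ‖T v + S v‖ ≤ ‖T v‖ + ‖S v‖ := norm_add_le _ _
    _ ≤ ‖T.domRestrict (closedSpan x)‖ * ‖v‖ + ε * ‖v‖ :=
      add_le_add ((T.domRestrict (closedSpan x)).le_opNorm ⟨v, hyx hv⟩) (hSy v hv)
    _ = _ := by rw [← add_mul]; rfl

theorem gammaD_add_eq {S : E →L[ℝ] Y} (hS : S ∈ DSS E Y) (T : E →L[ℝ] Y) :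
    gammaD (T + S) = gammaD T := by
  refine le_antisymm (gammaD_add_le hS T) ?_
  have hneg : -S ∈ DSS E Y := by simpa using smul_mem_DSS (-1) hS
  simpa using gammaD_add_le hneg (T + S)

/-- If `T + S` is strictly singular on `[x]`, so is `T` on a block span `[y]`: any `M` in `[y]` has
an infinite-dimensional part where `S` is small, and `T + S` is not bounded below there. -/
theorem add_mem_DNS {S T : E →L[ℝ] Y} (hS : S ∈ DSS E Y) (hT : T ∈ DNS E Y) : T + S ∈ DNS E Y := by
  rintro ⟨x, hx, hsing⟩
  obtain ⟨y, hy, hyx, hSy⟩ := exists_block_seq_of_mem_DSS hS hx one_pos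
  refine hT ⟨y, hy, ?_⟩
  rw [isStrictlySingular_domRestrict_iff _ (isClosed_closedSpan _)] at hsing ⊢
  intro M hM hMc hMf c hc
  obtain ⟨M', hM', hMc', hMf', hsmall⟩ :=
    exists_small_subspace hy S zero_le_one hSy (half_pos hc) hM hMc hMf
  obtain ⟨v, hv, hlt⟩ := hsing M' (hM'.trans (hM.trans (closedSpan_le_of_mem_span hyx))) hMc' hMf'
    (c / 2) (half_pos hc)
  refine ⟨v, hM' hv, ?_⟩
  calc ‖T v‖ = ‖(T + S) v - S v‖ := by simp
    _ ≤ ‖(T + S) v‖ + ‖S v‖ := norm_sub_le _ _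
    _ < c / 2 * ‖v‖ + c / 2 * ‖v‖ := add_lt_add_of_lt_of_le hlt (hsmall v hv)
    _ = c * ‖v‖ := by ring

end DSS

/-! ### Consequences of order continuity -/

section OrderContinuity

variable {E : Type*} [NormedAddCommGroup E] [Lattice E] [IsOrderedAddMonoid E]
  [NormedSpace ℝ E] [IsOrderedModule ℝ E] [HasSolidNorm E]

theorem nonpos_of_forall_nsmul_le {a b : E} (h : ∀ n : ℕ, n • a ≤ b) : a ≤ 0 := by
  have hle : ∀ n : ℕ, a ≤ ((n : ℝ) + 1)⁻¹ • b := by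
    intro n
    have h1 := h (n + 1)
    rw [← Nat.cast_smul_eq_nsmul ℝ] at h1
    have h2 := smul_le_smul_of_nonneg_left h1 (show 0 ≤ ((n : ℝ) + 1)⁻¹ by positivity)
    rwa [smul_smul, Nat.cast_add_one, inv_mul_cancel₀ (by positivity), one_smul] at h2
  have hlim : Filter.Tendsto (fun n : ℕ => ((n : ℝ) + 1)⁻¹ • b) Filter.atTop (nhds 0) := by
    have := (tendsto_one_div_add_atTop_nhds_zero_nat (𝕜 := ℝ)).smul_const b
    simpa using this
  exact ge_of_tendsto' hlim hle

/-- In an order continuous Banach lattice, the increments of an order bounded increasing sequence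
are eventually small. -/
theorem IsOrderContinuousNorm.eventually_norm_succ_sub_lt (hE : IsOrderContinuousNorm E)
    {s : ℕ → E} (hs : Monotone s) {u : E} (hu : ∀ n, s n ≤ u) {ε : ℝ} (hε : 0 < ε) :
    ∃ N, ∀ n, N ≤ n → ‖s (n + 1) - s n‖ < ε := by
  -- Gaps between upper bounds and terms: no supremum of `s` need be known to exist.
  have hsmall := hE {a | ∃ v n, (∀ m, s m ≤ v) ∧ v - s n = a} ⟨_, u, 0, hu, rfl⟩ ?_ ⟨?_, ?_⟩ ε hε
  · obtain ⟨_, ⟨v, N, hv, rfl⟩, hN⟩ := hsmall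
    refine ⟨N, fun n hn => lt_of_le_of_lt ?_
      (hN (v - s n) ⟨v, n, hv, rfl⟩ (sub_le_sub_left (hs hn) v))⟩
    refine norm_le_norm_of_abs_le_abs ?_
    rw [abs_of_nonneg (sub_nonneg.2 (hs n.le_succ)), abs_of_nonneg (sub_nonneg.2 (hv n))]
    exact sub_le_sub_right (hv _) _
  · rintro _ ⟨v, n, hv, rfl⟩ _ ⟨w, m, hw, rfl⟩
    exact ⟨_, ⟨v ⊓ w, max n m, fun k => le_inf (hv k) (hw k), rfl⟩,
      sub_le_sub inf_le_left (hs (le_max_left _ _)), sub_le_sub inf_le_right (hs (le_max_right _ _))⟩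
  · rintro _ ⟨v, n, hv, rfl⟩
    exact sub_nonneg.2 (hv n)
  · intro a ha
    -- A lower bound `a` of the gaps can be subtracted from any upper bound, leaving an upper bound;
    -- iterating forces `a ≤ 0`.
    have hub : ∀ k m : ℕ, s m ≤ u - k • a := by
      intro k
      induction k with
      | zero => simpa using hu
      | succ k ih =>
        intro m
        have : a ≤ u - k • a - s m := ha ⟨_, m, ih, rfl⟩
        rw [succ_nsmul, ← sub_sub]
        exact le_sub_comm.1 this
    exact nonpos_of_forall_nsmul_le (b := u - s 0) fun n => le_sub_comm.1 (hub n 0)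

/-- Sums of disjoint positive vectors are suprema, so the partial sums stay below `u`, and the `p n`
are their increments. -/
theorem IsOrderContinuousNorm.eventually_norm_lt_of_disjoint (hE : IsOrderContinuousNorm E)
    {p : ℕ → E} (hp : ∀ n, 0 ≤ p n) (hd : ∀ m n, m ≠ n → p m ⊓ p n = 0) {u : E}
    (hu : ∀ n, p n ≤ u) {ε : ℝ} (hε : 0 < ε) : ∃ N, ∀ n, N ≤ n → ‖p n‖ < ε := by
  have hu0 : 0 ≤ u := (hp 0).trans (hu 0)
  have hmem : ∀ m n, m ≠ n → p m ∈ disjointComplement (p n) := fun m n hmn => by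
    rw [mem_disjointComplement, abs_of_nonneg (hp n), abs_of_nonneg (hp m), hd n m hmn.symm]
  have hsum0 : ∀ n, 0 ≤ ∑ i ∈ Finset.range n, p i := fun n => Finset.sum_nonneg fun i _ => hp i
  have hbound : ∀ n, ∑ i ∈ Finset.range n, p i ≤ u := by
    intro n
    induction n with
    | zero => simpa using hu0
    | succ n ih =>
      have hdisj : ∑ i ∈ Finset.range n, p i ∈ disjointComplement (p n) :=
        Submodule.sum_mem _ fun i hi => hmem i n (Finset.mem_range.1 hi).ne
      rw [mem_disjointComplement, abs_of_nonneg (hp n), abs_of_nonneg (hsum0 n)] at hdisj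
      rw [Finset.sum_range_succ, add_comm, ← inf_add_sup, hdisj, zero_add]
      exact sup_le (hu n) ih
  have hmono : Monotone fun n => ∑ i ∈ Finset.range n, p i :=
    monotone_nat_of_le_succ fun n => by
      rw [Finset.sum_range_succ]
      exact le_add_of_nonneg_right (hp n)
  obtain ⟨N, hN⟩ := hE.eventually_norm_succ_sub_lt hmono hbound hε
  exact ⟨N, fun n hn => by simpa [Finset.sum_range_succ] using hN n hn⟩

theorem IsOrderContinuousNorm.eventually_norm_inf_smul_lt (hE : IsOrderContinuousNorm E)
    {x : ℕ → E} (hx : x ∈ disjointSeqs E) (u : E) {c : ℝ} (hc : 0 ≤ c) {ε : ℝ} (hε : 0 < ε) :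
    ∃ N, ∀ n, N ≤ n → ‖|u| ⊓ c • |x n|‖ < ε := by
  have h0 : ∀ n, 0 ≤ c • |x n| := fun n => smul_nonneg hc (abs_nonneg _)
  refine hE.eventually_norm_lt_of_disjoint (u := |u|) (fun n => le_inf (abs_nonneg _) (h0 n))
    (fun m n hmn => ?_) (fun n => inf_le_left) hε
  refine le_antisymm ?_ (le_inf (le_inf (abs_nonneg _) (h0 m)) (le_inf (abs_nonneg _) (h0 n)))
  have h1 := inf_smul_eq_zero (abs_nonneg _) (abs_nonneg _) (hx.2 m n hmn) hc
  rw [inf_comm] at h1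
  have h2 := inf_smul_eq_zero (h0 n) (abs_nonneg _) h1 hc
  rw [← h2, inf_comm (c • |x n|)]
  exact inf_le_inf inf_le_right inf_le_right

end OrderContinuity

/-! ### Soft thresholding -/

section SoftThreshold

variable {E : Type*} [NormedAddCommGroup E] [Lattice E] [IsOrderedAddMonoid E]

/-- The vector obtained from `v` by lowering its modulus by `w`, down to zero at most. -/
def softThreshold (v w : E) : E := (v - w)⁺ - (-v - w)⁺

theorem abs_softThreshold_le (v w : E) : |softThreshold v w| ≤ (|v| - w)⁺ := by
  have h1 : (v - w)⁺ ≤ (|v| - w)⁺ := posPart_mono (sub_le_sub_right (le_abs_self v) w)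
  have h2 : (-v - w)⁺ ≤ (|v| - w)⁺ := posPart_mono (sub_le_sub_right (neg_le_abs v) w)
  refine abs_le'.2 ⟨(sub_le_self _ (posPart_nonneg _)).trans h1, ?_⟩
  rw [softThreshold, neg_sub]
  exact (sub_le_self _ (posPart_nonneg _)).trans h2

omit [IsOrderedAddMonoid E] in
theorem softThreshold_neg (v w : E) : softThreshold (-v) w = -softThreshold v w := by
  simp [softThreshold]

theorem sub_softThreshold_le (v : E) {w : E} (hw : 0 ≤ w) : v - softThreshold v w ≤ w := by
  have h1 : (-v - w)⁺ ≤ (v - w)⁻ := by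
    rw [← posPart_neg, neg_sub]
    refine posPart_mono ?_
    rw [sub_eq_add_neg, sub_eq_add_neg, add_comm]
    gcongr
    exact neg_le_self hw
  rw [sub_le_comm, softThreshold]
  calc v - w = (v - w)⁺ - (v - w)⁻ := (posPart_sub_negPart _).symm
    _ ≤ _ := sub_le_sub_left h1 _

theorem abs_sub_softThreshold_le (v : E) {w : E} (hw : 0 ≤ w) : |v - softThreshold v w| ≤ w := by
  refine abs_le'.2 ⟨sub_softThreshold_le v hw, ?_⟩
  have := sub_softThreshold_le (-v) hw
  rwa [softThreshold_neg, ← neg_sub'] at this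

theorem norm_sub_softThreshold_le [HasSolidNorm E] (v : E) {w : E} (hw : 0 ≤ w) :
    ‖v - softThreshold v w‖ ≤ ‖w‖ :=
  norm_le_norm_of_abs_le_abs ((abs_sub_softThreshold_le v hw).trans (le_abs_self w))

variable [NormedSpace ℝ E] [IsOrderedModule ℝ E]

/-- The two moduli are dominated by the positive part of `|u| - c • |v|` and by `c⁻¹` times its
negative part, which are disjoint. -/
theorem abs_softThreshold_inf_eq_zero {u v w w' : E} {c : ℝ} (hc : 0 < c)
    (hw : |u| ⊓ c • |v| ≤ w) (hw' : |v| ⊓ c⁻¹ • |u| ≤ w') :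
    |softThreshold u w| ⊓ |softThreshold v w'| = 0 := by
  have h1 : |softThreshold u w| ≤ (|u| - c • |v|)⁺ := by
    refine (abs_softThreshold_le u w).trans ?_
    rw [posPart_def, posPart_def]
    refine sup_le ?_ le_sup_right
    refine (sub_le_sub_left hw _).trans ?_
    rw [sub_inf, sub_self, sup_comm]
  have h2 : |softThreshold v w'| ≤ (|v| - c⁻¹ • |u|)⁺ := by
    refine (abs_softThreshold_le v w').trans ?_
    rw [posPart_def, posPart_def]
    refine sup_le ?_ le_sup_right
    refine (sub_le_sub_left hw' _).trans ?_
    rw [sub_inf, sub_self, sup_comm]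
  have h3 : (|v| - c⁻¹ • |u|)⁺ ≤ c⁻¹ • (|u| - c • |v|)⁻ := by
    rw [posPart_def]
    refine sup_le ?_ (smul_nonneg (inv_nonneg.2 hc.le) (negPart_nonneg _))
    have := smul_le_smul_of_nonneg_left (neg_le_negPart (|u| - c • |v|)) (inv_nonneg.2 hc.le)
    rwa [neg_sub, smul_sub, smul_smul, inv_mul_cancel₀ hc.ne', one_smul] at this
  refine le_antisymm ?_ (le_inf (abs_nonneg _) (abs_nonneg _))
  rw [← inf_smul_eq_zero (posPart_nonneg _) (negPart_nonneg _)
    (posPart_inf_negPart_eq_zero (|u| - c • |v|)) (inv_nonneg.2 hc.le)]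
  exact inf_le_inf h1 (h2.trans h3)

end SoftThreshold

/-! ### Openness of `DNS` -/

section DNS

variable {E Y : Type*} [NormedAddCommGroup E] [Lattice E] [IsOrderedAddMonoid E]
  [NormedSpace ℝ E] [IsOrderedModule ℝ E] [HasSolidNorm E]
  [NormedAddCommGroup Y] [NormedSpace ℝ Y]

omit [HasSolidNorm E] in
theorem exists_normalized_disjointSeq {x : ℕ → E} (hx : x ∈ disjointSeqs E) :
    (fun n => ‖x n‖⁻¹ • x n) ∈ disjointSeqs E ∧ ∀ n, ‖‖x n‖⁻¹ • x n‖ = 1 := by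
  refine ⟨⟨fun n => ?_, fun m n hmn => ?_⟩, fun n => norm_smul_inv_norm (𝕜 := ℝ) (hx.1 n)⟩
  · exact smul_ne_zero (inv_ne_zero (norm_ne_zero_iff.2 (hx.1 n))) (hx.1 n)
  · refine Submodule.smul_mem (disjointComplement _) _ ?_
    rw [mem_disjointComplement_comm]
    exact Submodule.smul_mem _ _ (hx.2 n m hmn.symm)

theorem exists_disjointSeq_norm_le_of_mem_closure {T : E →L[ℝ] Y} (hT : T ∈ closure (DNS E Y)ᶜ)
    {δ : ℝ} (hδ : 0 < δ) :
    ∃ x ∈ disjointSeqs E, (∀ n, ‖x n‖ = 1) ∧ ∀ n, ‖T (x n)‖ ≤ δ := by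
  obtain ⟨S, hS, hST⟩ := Metric.mem_closure_iff.1 hT (δ / 2) (half_pos hδ)
  obtain ⟨x, hx, hsing⟩ := not_not.1 hS
  obtain ⟨y, hy, -, hSy⟩ := exists_block_seq_of_isStrictlySingular hx hsing (half_pos hδ)
  obtain ⟨hz, hz1⟩ := exists_normalized_disjointSeq hy
  refine ⟨_, hz, hz1, fun n => ?_⟩
  rw [dist_eq_norm] at hST
  have hpos : 0 < ‖y n‖ := norm_pos_iff.2 (hy.1 n)
  rw [map_smul, norm_smul, norm_inv, norm_norm, inv_mul_le_iff₀ hpos]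
  calc ‖T (y n)‖ = ‖(T - S) (y n) + S (y n)‖ := by simp
    _ ≤ ‖(T - S) (y n)‖ + ‖S (y n)‖ := norm_add_le _ _
    _ ≤ δ / 2 * ‖y n‖ + δ / 2 * 1 * ‖y n‖ := by
      refine add_le_add ((T - S).le_of_opNorm_le hST.le _) ((hSy n).trans ?_)
      gcongr
      exact pow_le_one₀ (by norm_num) (by norm_num)
    _ = ‖y n‖ * δ := by ring

/-- Unit vectors that are almost disjoint, with prescribed precision, and on which `T` is
small. -/
theorem exists_almost_disjoint_seq (hE : IsOrderContinuousNorm E) {T : E →L[ℝ] Y}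
    (hT : T ∈ closure (DNS E Y)ᶜ) :
    ∃ (k : ℕ → ℕ) (v : ℕ → E), (∀ n, n ≤ k n) ∧ (∀ n, ‖v n‖ = 1) ∧
      (∀ n, ‖T (v n)‖ ≤ (1 / 2) ^ k n) ∧
      ∀ m n, m < n → ‖|v m| ⊓ (4 : ℝ) ^ (k n + 2) • |v n|‖ ≤ ((4 : ℝ) ^ (k n + 2))⁻¹ := by
  obtain ⟨f, hP, hr⟩ := exists_seq_of_forall_finset_exists
    (fun p : ℕ × E => ‖p.2‖ = 1 ∧ ‖T p.2‖ ≤ (1 / 2) ^ p.1)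
    (fun p q => p.1 < q.1 ∧
      ‖|p.2| ⊓ (4 : ℝ) ^ (q.1 + 2) • |q.2|‖ ≤ ((4 : ℝ) ^ (q.1 + 2))⁻¹) (fun s _ => by
    set k := s.sup Prod.fst + 1
    obtain ⟨x, hx, hx1, hTx⟩ := exists_disjointSeq_norm_le_of_mem_closure hT
      (show (0 : ℝ) < (1 / 2) ^ k by positivity)
    have hN := fun p : ℕ × E => hE.eventually_norm_inf_smul_lt hx p.2
      (show (0 : ℝ) ≤ 4 ^ (k + 2) by positivity)
      (show (0 : ℝ) < ((4 : ℝ) ^ (k + 2))⁻¹ by positivity)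
    choose N hN using hN
    exact ⟨(k, x (s.sup N)), ⟨hx1 _, hTx _⟩, fun p hp =>
      ⟨Nat.lt_succ_of_le (Finset.le_sup hp), (hN p _ (Finset.le_sup hp)).le⟩⟩)
  have hmono : StrictMono fun n => (f n).1 := fun m n hmn => (hr m n hmn).1
  exact ⟨fun n => (f n).1, fun n => (f n).2, fun n => hmono.le_apply, fun n => (hP n).1,
    fun n => (hP n).2, fun m n hmn => (hr m n hmn).2⟩

/-- Almost disjoint unit vectors can be perturbed to disjoint vectors. -/
theorem exists_disjointSeq_near [CompleteSpace E] {k : ℕ → ℕ} {v : ℕ → E} (hk : ∀ n, n ≤ k n)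
    (hv : ∀ n, ‖v n‖ = 1)
    (h : ∀ m n, m < n → ‖|v m| ⊓ (4 : ℝ) ^ (k n + 2) • |v n|‖ ≤ ((4 : ℝ) ^ (k n + 2))⁻¹) :
    ∃ z ∈ disjointSeqs E, ∀ n, ‖v n - z n‖ ≤ 1 / 2 * (1 / 2) ^ n := by
  -- Off the diagonal `c m n` and `c n m` are inverse, as thresholding requires. For `m < n` the
  -- overlap is small by `h`; for `n < m` the weight alone makes it small.
  let c : ℕ → ℕ → ℝ := fun m n => if m < n then 4 ^ (k n + 2) else ((4 : ℝ) ^ (k m + 2))⁻¹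
  have hc : ∀ m n, 0 < c m n := fun m n => by
    simp only [c]
    split_ifs <;> positivity
  let p : ℕ → ℕ → E := fun m n => if m = n then 0 else |v m| ⊓ c m n • |v n|
  have hp0 : ∀ m n, 0 ≤ p m n := fun m n => by
    simp only [p]
    split_ifs
    · exact le_rfl
    · exact le_inf (abs_nonneg _) (smul_nonneg (hc m n).le (abs_nonneg _))
  have hpow : ∀ m n : ℕ, m ≤ n →
      ((4 : ℝ) ^ (k n + 2))⁻¹ ≤ 1 / 4 * (1 / 2) ^ m * (1 / 2) ^ n := by
    intro m n hmn
    calc ((4 : ℝ) ^ (k n + 2))⁻¹ ≤ ((4 : ℝ) ^ (n + 1))⁻¹ := by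
          refine inv_anti₀ (by positivity) (pow_le_pow_right₀ (by norm_num) ?_)
          have := hk n
          omega
      _ = 1 / 4 * (1 / 2) ^ n * (1 / 2) ^ n := by
          rw [← inv_pow, pow_succ, mul_assoc, ← mul_pow]
          norm_num
          ring
      _ ≤ _ := by
          gcongr ?_ * ?_ * _
          exact pow_le_pow_of_le_one (by norm_num) (by norm_num) hmn
  have hp : ∀ m n, ‖p m n‖ ≤ 1 / 4 * (1 / 2) ^ m * (1 / 2) ^ n := by
    intro m n
    rcases lt_trichotomy m n with hmn | rfl | hmn
    · simp only [p, c, if_neg hmn.ne, if_pos hmn]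
      exact (h m n hmn).trans (hpow m n hmn.le)
    · simp only [p, if_true, norm_zero]
      positivity
    · simp only [p, c, if_neg hmn.ne', if_neg hmn.not_gt]
      have h4 : (0 : ℝ) < ((4 : ℝ) ^ (k m + 2))⁻¹ := by positivity
      calc _ ≤ ‖((4 : ℝ) ^ (k m + 2))⁻¹ • |v n|‖ := by
            refine norm_le_norm_of_abs_le_abs ?_
            have h0 : 0 ≤ ((4 : ℝ) ^ (k m + 2))⁻¹ • |v n| := smul_nonneg h4.le (abs_nonneg _)
            rw [abs_of_nonneg h0, abs_of_nonneg (le_inf (abs_nonneg _) h0)]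
            exact inf_le_right
        _ = ((4 : ℝ) ^ (k m + 2))⁻¹ := by
            rw [norm_smul, norm_abs_eq_norm, hv, mul_one, Real.norm_of_nonneg h4.le]
        _ ≤ _ := (hpow n m hmn.le).trans_eq (by ring)
  have hsum : ∀ m, Summable (p m) := fun m =>
    Summable.of_norm_bounded (summable_geometric_two.mul_left _) (hp m)
  have hw0 : ∀ m, 0 ≤ ∑' n, p m n := fun m => tsum_nonneg (hp0 m)
  have hw : ∀ m, ‖∑' n, p m n‖ ≤ 1 / 2 * (1 / 2) ^ m := by
    intro m
    refine (tsum_of_norm_bounded (hasSum_geometric_two.mul_left _) (hp m)).trans_eq ?_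
    ring
  have hle : ∀ m n, m ≠ n → |v m| ⊓ c m n • |v n| ≤ ∑' n, p m n := by
    intro m n hmn
    have := (hsum m).le_tsum n fun i _ => hp0 m i
    simpa only [p, if_neg hmn] using this
  have hcinv : ∀ m n, m ≠ n → (c m n)⁻¹ = c n m := by
    intro m n hmn
    rcases hmn.lt_or_gt with hlt | hlt
    · simp only [c, if_pos hlt, if_neg hlt.not_gt]
    · simp only [c, if_pos hlt, if_neg hlt.not_gt, inv_inv]
  have hnear : ∀ n, ‖v n - softThreshold (v n) (∑' i, p n i)‖ ≤ 1 / 2 * (1 / 2) ^ n :=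
    fun n => (norm_sub_softThreshold_le _ (hw0 n)).trans (hw n)
  refine ⟨fun n => softThreshold (v n) (∑' i, p n i), ⟨fun n hn => ?_, fun m n hmn => ?_⟩, hnear⟩
  -- The perturbation has norm at most `1 / 2`, too little to annihilate a unit vector.
  · have h1 := hnear n
    rw [show softThreshold (v n) (∑' i, p n i) = 0 from hn, sub_zero, hv] at h1
    have : (1 / 2 : ℝ) ^ n ≤ 1 := pow_le_one₀ (by norm_num) (by norm_num)
    linarith
  · refine abs_softThreshold_inf_eq_zero (hc m n) (hle m n hmn) ?_
    rw [hcinv m n hmn]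
    exact hle n m hmn.symm

theorem IsOrderContinuousNorm.isOpen_DNS [CompleteSpace E] (hE : IsOrderContinuousNorm E) :
    IsOpen (DNS E Y) := by
  rw [← isClosed_compl_iff]
  refine isClosed_of_closure_subset fun T hT => ?_
  obtain ⟨k, v, hk, hv, hTv, hvv⟩ := exists_almost_disjoint_seq hE hT
  obtain ⟨z, hz, hzv⟩ := exists_disjointSeq_near hk hv hvv
  -- `‖T (z n)‖` is at most `(1 + ‖T‖ / 2) * (1 / 2) ^ n`; the factor `2` in `K` pays for `‖z n‖ ≥ 1
  -- / 2`.
  refine not_not.2 ⟨z, hz, isStrictlySingular_of_summable hz T (K := 2 + ‖T‖) (by positivity)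
    fun n => ?_⟩
  have hz1 : 1 / 2 ≤ ‖z n‖ := by
    have h1 : ‖v n‖ ≤ ‖z n‖ + ‖v n - z n‖ := by simpa using norm_add_le (z n) (v n - z n)
    have h2 : (1 / 2 : ℝ) ^ n ≤ 1 := pow_le_one₀ (by norm_num) (by norm_num)
    linarith [hzv n, hv n]
  calc ‖T (z n)‖ = ‖T (v n) - T (v n - z n)‖ := by simp
    _ ≤ ‖T (v n)‖ + ‖T (v n - z n)‖ := norm_sub_le _ _
    _ ≤ (1 / 2) ^ n + ‖T‖ * (1 / 2 * (1 / 2) ^ n) := by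
      refine add_le_add ((hTv n).trans ?_) (T.le_opNorm_of_le (hzv n))
      exact pow_le_pow_of_le_one (by norm_num) (by norm_num) (hk n)
    _ = (2 + ‖T‖) * (1 / 2) ^ n * (1 / 2) := by ring
    _ ≤ _ := by gcongr

end DNS

theorem corollary4p6 {E Y : Type*}
    [NormedAddCommGroup E] [NormedSpace ℝ E] [CompleteSpace E] [Lattice E]
    [IsOrderedAddMonoid E] [IsOrderedModule ℝ E] [HasSolidNorm E]
    [NormedAddCommGroup Y] [NormedSpace ℝ Y] [CompleteSpace Y]
    (hE : IsOrderContinuousNorm E) :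
    (∃ V : Submodule ℝ (E →L[ℝ] Y),
      (V : Set (E →L[ℝ] Y)) = DSS E Y ∧ IsClosed (V : Set (E →L[ℝ] Y))) ∧
    IsOpen (DNS E Y) ∧
    (∀ S ∈ DSS E Y, ∀ T : E →L[ℝ] Y, gammaD (T + S) = gammaD T) ∧
    (∀ S ∈ DSS E Y, ∀ T ∈ DNS E Y, T + S ∈ DNS E Y) :=
  ⟨⟨DSSSubmodule E Y, rfl, isClosed_DSS⟩, hE.isOpen_DNS, fun _ hS T => gammaD_add_eq hS T,
    fun _ hS _ hT => add_mem_DNS hS hT⟩
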